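/- For $q>1$, the (Poissonized) base-$q$ LogLog sketch $q$-LL has state space $\mathbb Z$, and at cardinality $\lambda>0$ it is in state $k$ with probability $$\psi_{q,\lambda}(k)=e^{-\lambda/q^{k}}-e^{-\lambda/q^{k-1}}.$$ Write $H_q(\lambda)=-\sum_{k\in\mathbb Z}\psi_{q,\lambda}(k)\log_2\psi_{q,\lambda}(k)$ for its Shannon entropy and $I_q(\lambda)=\sum_{k\in\mathbb Z}\psi_{q,\lambda}(k)\left(\frac{\partial_\lambda\psi_{q,\lambda}(k)}{\psi_{q,\lambda}(k)}\right)^2$ for its Fisher information with respect to $\lambda$. The Fish number of $q$-LL is $$\mathsf{Fish}(q\text{-LL})=\frac{\int_0^1 H_q(q^{r})\,dr}{\int_0^1 q^{2r}I_q(q^{r})\,dr}.$$ Let $h(x)=-x\ln x-(1-x)\ln(1-x)$, $g(x)=\frac{x^2}{e^x-1}$, and $$H_0=\frac1{\ln 2}\int_{-\infty}^{\infty}h\!\left(e^{-e^{w}}\right)dw,\qquad I_0=\int_{-\infty}^{\infty}g\!\left(e^{w}\right)dw,$$ $$\phi(q)=\int_{-\infty}^{\infty}-\left(e^{-e^r}-e^{-e^rq}\right)\log_2\left(e^{-e^r}-e^{-e^rq}\right)dr,\qquad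 \rho(q)=\int_{-\infty}^{\infty}\frac{\left(-e^re^{-e^r}+e^rq\,e^{-e^rq}\right)^2}{e^{-e^r}-e^{-e^rq}}\,dr.$$ **Theorem.** The integrals defining $H_0$ and $I_0$ converge absolutely and $I_0>0$. For every real $q>1$, $\psi_{q,\lambda}$ is a probability distribution on $\mathbb Z$ for each $\lambda>0$; the sketch $q$-LL is weakly scale-invariant with base $q$, i.e. $H_q(\lambda)=H_q(q\lambda)$ and $I_q(\lambda)=q^2I_q(q\lambda)$ for all $\lambda>0$; all sums and integrals above converge absolutely, with $\int_0^1q^{2r}I_q(q^r)\,dr>0$ and $\rho(q)>0$; and $$\mathsf{Fish}(q\text{-LL})=\frac{\phi(q)}{\rho(q)}>\frac{H_0}{I_0}.$$ Furthermore, $$\lim_{q\to\infty}\mathsf{Fish}(q\text{-LL})=\frac{H_0}{I_0}.$$ -/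

import Mathlib

open Filter Topology MeasureTheory

noncomputable section

namespace Sketch

/-- `ψ t x` is the probability that a sketch with state space `M` is in state `x` at cardinality
`t`. The family `ψ` is an induced distribution family when every `ψ t` with `t > 0` is a
probability mass function on the countable type `M`. -/
structure IsInducedFamily {M : Type*} [Countable M] (ψ : ℝ → M → ℝ) : Prop where
  nonneg : ∀ t : ℝ, 0 < t → ∀ x, 0 ≤ ψ t x
  hasSum_one : ∀ t : ℝ, 0 < t → HasSum (ψ t) 1

/-- The summand `p(x) · (-log₂ p(x))` of the Shannon entropy of a mass function `p`. -/
def entropyTerm {M : Type*} (p : M → ℝ) (x : M) : ℝ :=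
  p x * (-Real.logb 2 (p x))

/-- Shannon entropy in bits, `E(-log₂ p(X))` for `X ∼ p`. -/
def entropy {M : Type*} (p : M → ℝ) : ℝ :=
  ∑' x, entropyTerm p x

/-- The summand `ψ_t(x) · ((∂/∂t ψ_t(x)) / ψ_t(x))²` of the Fisher information. -/
def fisherTerm {M : Type*} (ψ : ℝ → M → ℝ) (t : ℝ) (x : M) : ℝ :=
  ψ t x * (deriv (fun s => ψ s x) t / ψ t x) ^ 2

/-- Fisher information of the parameter (the cardinality) at `t`,
`E(((∂/∂t ψ_t(X)) / ψ_t(X))²)` for `X ∼ ψ_t`. -/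
def fisherInfo {M : Type*} (ψ : ℝ → M → ℝ) (t : ℝ) : ℝ :=
  ∑' x, fisherTerm ψ t x

/-- Weak scale-invariance with base `q`. -/
def WeaklyScaleInvariant {M : Type*} (ψ : ℝ → M → ℝ) (q : ℝ) : Prop :=
  ∀ t : ℝ, 0 < t →
    entropy (ψ t) = entropy (ψ (q * t)) ∧
    fisherInfo ψ t = q ^ 2 * fisherInfo ψ (q * t)

/-- Average entropy `∫₀¹ H(X_{q^r}) dr`. -/
def avgEntropy {M : Type*} (ψ : ℝ → M → ℝ) (q : ℝ) : ℝ :=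
  ∫ r in (0 : ℝ)..1, entropy (ψ (q ^ r))

/-- Average normalized Fisher information `∫₀¹ q^{2r} I(q^r) dr`. -/
def avgInfo {M : Type*} (ψ : ℝ → M → ℝ) (q : ℝ) : ℝ :=
  ∫ r in (0 : ℝ)..1, q ^ (2 * r) * fisherInfo ψ (q ^ r)

/-- The Fisher–Shannon number of a sketch that is weakly scale-invariant with base `q`. -/
def fish {M : Type*} (ψ : ℝ → M → ℝ) (q : ℝ) : ℝ :=
  avgEntropy ψ q / avgInfo ψ q

/-- The base-`q` LogLog sketch (Poissonized, state space `ℤ`):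
state `k` has probability `e^{-t/q^k} - e^{-t/q^{k-1}}` at cardinality `t`. -/
def qLL (q : ℝ) (t : ℝ) (k : ℤ) : ℝ :=
  Real.exp (-(t / q ^ k)) - Real.exp (-(t / q ^ (k - 1)))

/-- `h(x) = -x ln x - (1-x) ln (1-x)`. -/
def h (x : ℝ) : ℝ :=
  -x * Real.log x - (1 - x) * Real.log (1 - x)

/-- `g(x) = x² / (e^x - 1)`. -/
def g (x : ℝ) : ℝ :=
  x ^ 2 / (Real.exp x - 1)

def H₀ : ℝ :=
  1 / Real.log 2 * ∫ w : ℝ, h (Real.exp (-Real.exp w))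

def I₀ : ℝ :=
  ∫ w : ℝ, g (Real.exp w)

/-- The integrand of `φ(q)`. -/
def phiIntegrand (q r : ℝ) : ℝ :=
  -(Real.exp (-Real.exp r) - Real.exp (-(Real.exp r * q))) *
    Real.logb 2 (Real.exp (-Real.exp r) - Real.exp (-(Real.exp r * q)))

/-- The integrand of `ρ(q)`. -/
def rhoIntegrand (q r : ℝ) : ℝ :=
  (-(Real.exp r * Real.exp (-Real.exp r)) +
      Real.exp r * q * Real.exp (-(Real.exp r * q))) ^ 2 /
    (Real.exp (-Real.exp r) - Real.exp (-(Real.exp r * q)))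

def phi (q : ℝ) : ℝ := ∫ r : ℝ, phiIntegrand q r

def rho (q : ℝ) : ℝ := ∫ r : ℝ, rhoIntegrand q r

end Sketch

end

/-!
The state of `q`-LL is found by inspecting the columns from the top down until the first nonempty
one. Correspondingly, `e^{-x} - e^{-xq} = e^{-x} (1 - e^{-x (q - 1)})` splits entropy and Fisher
information by the chain rule: the integrands of `φ(q)` and `ρ(q)` are the terms
`W(w) h(e^{-e^w}) / ln 2` and `W(w) g(e^w)` of one column, translated in `w`, plus a difference
`K(r) - K(r + ln q)` that integrates to zero. Here `W(w) = e^{-e^w / (q - 1)}` is the probability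
that the inspection reaches the column of rate `e^w`.

Since `W` is strictly decreasing, and so is `h(e^{-x}) / g(x)`, Chebyshev's integral inequality
gives `φ(q) / ρ(q) > H₀ / I₀`. As `q → ∞` the weight `W` increases to `1`, which gives the limit.
Averaging over one period turns the sums over `ℤ` that define `Fish(q-LL)` into integrals over `ℝ`.
-/

namespace Sketch

open Real

theorem integrable_exp_neg_mul_abs {a : ℝ} (ha : 0 < a) :
    Integrable fun s : ℝ => exp (-(a * |s|)) := by
  rw [← integrableOn_univ, ← Set.Iic_union_Ioi (a := (0 : ℝ))]
  refine IntegrableOn.union ?_ ?_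
  · refine (integrableOn_exp_mul_Iic ha 0).congr_fun (fun s hs => ?_) measurableSet_Iic
    simp only [abs_of_nonpos (Set.mem_Iic.1 hs), mul_neg, neg_neg]
  · refine (integrableOn_exp_mul_Ioi (neg_lt_zero.2 ha) 0).congr_fun (fun s hs => ?_)
      measurableSet_Ioi
    simp only [abs_of_pos (Set.mem_Ioi.1 hs), neg_mul]

theorem summable_exp_neg_mul_abs_intCast {a : ℝ} (ha : 0 < a) :
    Summable fun k : ℤ => exp (-(a * |(k : ℝ)|)) := by
  have hnat : Summable fun n : ℕ => exp (-(a * n)) := by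
    simpa only [mul_neg, mul_comm] using summable_exp_nat_mul_iff.2 (neg_lt_zero.2 ha)
  refine Summable.of_nat_of_neg ?_ ?_ <;> simpa using hnat

/-- A continuous function on the real line that is exponentially small at both ends. All sums and
integrals below converge because their terms have this property. -/
structure ExpDecay (G : ℝ → ℝ) : Prop where
  continuous : Continuous G
  isBigO : ∃ a > 0, G =O[⊤] fun s => exp (-(a * |s|))

namespace ExpDecay

variable {G K : ℝ → ℝ}

theorem integrable (hG : ExpDecay G) : Integrable G := by
  obtain ⟨a, ha, hGa⟩ := hG.isBigO
  exact hGa.integrable hG.continuous.aestronglyMeasurable (integrable_exp_neg_mul_abs ha)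

theorem isBigO_exp_neg_mul_abs_of_le {a b : ℝ} (hab : a ≤ b) :
    (fun s => exp (-(b * |s|))) =O[⊤] fun s : ℝ => exp (-(a * |s|)) :=
  Asymptotics.isBigO_of_le _ fun s => by
    simp only [norm_eq_abs, abs_exp]
    gcongr

theorem add (hG : ExpDecay G) (hK : ExpDecay K) : ExpDecay fun s => G s + K s := by
  obtain ⟨a, ha, hGa⟩ := hG.isBigO
  obtain ⟨b, hb, hKb⟩ := hK.isBigO
  exact ⟨hG.continuous.add hK.continuous, min a b, lt_min ha hb,
    (hGa.trans (isBigO_exp_neg_mul_abs_of_le (min_le_left a b))).add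
      (hKb.trans (isBigO_exp_neg_mul_abs_of_le (min_le_right a b)))⟩

theorem bdd_mul (hG : ExpDecay G) (hK : Continuous K) {B : ℝ} (hB : ∀ s, |K s| ≤ B) :
    ExpDecay fun s => K s * G s := by
  obtain ⟨a, ha, hGa⟩ := hG.isBigO
  have hK1 : K =O[⊤] fun _ => (1 : ℝ) := Asymptotics.isBigO_of_le' (c := B) _ (by simpa using hB)
  exact ⟨hK.mul hG.continuous, a, ha, by simpa only [one_mul] using hK1.mul hGa⟩

theorem const_mul (hG : ExpDecay G) (c : ℝ) : ExpDecay fun s => c * G s :=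
  hG.bdd_mul continuous_const fun _ => le_refl |c|

theorem sub (hG : ExpDecay G) (hK : ExpDecay K) : ExpDecay fun s => G s - K s := by
  simpa [sub_eq_add_neg] using hG.add (hK.const_mul (-1))

theorem comp_add_right (hG : ExpDecay G) (c : ℝ) : ExpDecay fun s => G (s + c) := by
  obtain ⟨a, ha, hGa⟩ := hG.isBigO
  have hshift : (fun s => exp (-(a * |s + c|))) =O[⊤] fun s => exp (-(a * |s|)) := by
    refine Asymptotics.isBigO_of_le' (c := exp (a * |c|)) _ fun s => ?_
    simp only [norm_eq_abs, abs_exp, ← exp_add]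
    have htri : |s| ≤ |s + c| + |c| := by simpa using abs_sub (s + c) c
    exact exp_le_exp.2 (by nlinarith)
  exact ⟨hG.continuous.comp (by fun_prop), a, ha,
    (hGa.comp_tendsto (k := fun s => s + c) tendsto_top).trans hshift⟩

theorem comp_mul_right (hG : ExpDecay G) {b : ℝ} (hb : 0 < b) : ExpDecay fun s => G (s * b) := by
  obtain ⟨a, ha, hGa⟩ := hG.isBigO
  refine ⟨hG.continuous.comp (by fun_prop), a * b, mul_pos ha hb, ?_⟩
  simpa only [Function.comp_def, abs_mul, abs_of_pos hb, mul_assoc, mul_comm b] using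
    hGa.comp_tendsto (k := fun s => s * b) tendsto_top

theorem summable_intCast (hG : ExpDecay G) : Summable fun k : ℤ => G k := by
  obtain ⟨a, ha, hGa⟩ := hG.isBigO
  exact summable_of_isBigO (summable_exp_neg_mul_abs_intCast ha)
    (hGa.comp_tendsto (k := fun k : ℤ => (k : ℝ)) tendsto_top)

theorem summable_sub_intCast (hG : ExpDecay G) (r : ℝ) : Summable fun k : ℤ => G (r - k) := by
  refine ((Equiv.neg ℤ).summable_iff.2 (hG.comp_add_right r).summable_intCast).congr fun k => ?_
  simp [neg_add_eq_sub]

theorem shift_add_sub (hG : ExpDecay G) (hK : ExpDecay K) (a b : ℝ) :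
    ExpDecay fun r => G (r + a) + (K r - K (r + b)) :=
  (hG.comp_add_right a).add (hK.sub (hK.comp_add_right b))

theorem integral_shift_add_sub (hG : ExpDecay G) (hK : ExpDecay K) (a b : ℝ) :
    ∫ r, (G (r + a) + (K r - K (r + b))) = ∫ r, G r := by
  have hKb := hK.comp_add_right b
  rw [integral_add (hG.comp_add_right a).integrable (hK.sub hKb).integrable,
    integral_sub hK.integrable hKb.integrable, integral_add_right_eq_self G,
    integral_add_right_eq_self K, sub_self, add_zero]

/-- The constant on the right comes from the tangent to `c * exp s` at the point
`log (2 * p / c)`, whose slope `2 * p` leaves a margin `p * s` for `s ≥ 0`. -/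
theorem mul_sub_mul_exp_le {p c : ℝ} (hp : 0 < p) (hc : 0 < c) (s : ℝ) :
    p * s - c * exp s ≤ |2 * p * (log (2 * p / c) - 1)| - p * |s| := by
  rcases le_total s 0 with hs | hs
  · rw [abs_of_nonpos hs]
    nlinarith [abs_nonneg (2 * p * (log (2 * p / c) - 1)), mul_pos hc (exp_pos s)]
  · have htangent := add_one_le_exp (s - log (2 * p / c))
    rw [exp_sub, exp_log (by positivity), le_div_iff₀ (by positivity), mul_div_assoc',
      div_le_iff₀ hc] at htangent
    rw [abs_of_nonneg hs]
    nlinarith [le_abs_self (2 * p * (log (2 * p / c) - 1))]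

theorem of_abs_le_rpow_mul_exp {F : ℝ → ℝ} {p c : ℝ} (hF : Continuous fun s => F (exp s))
    (hp : 0 < p) (hc : 0 < c) (hle : ∀ x, 0 < x → |F x| ≤ x ^ p * exp (-(c * x))) :
    ExpDecay fun s => F (exp s) := by
  refine ⟨hF, p, hp, Asymptotics.isBigO_of_le' (c := exp |2 * p * (log (2 * p / c) - 1)|) _
    fun s => ?_⟩
  simp only [norm_eq_abs, abs_exp]
  calc |F (exp s)| ≤ exp s ^ p * exp (-(c * exp s)) := hle _ (exp_pos s)
    _ = exp (p * s - c * exp s) := by rw [← exp_mul, ← exp_add, mul_comm s, sub_eq_add_neg]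
    _ ≤ exp (|2 * p * (log (2 * p / c) - 1)| - p * |s|) :=
        exp_le_exp.2 (mul_sub_mul_exp_le hp hc s)
    _ = _ := by rw [sub_eq_add_neg, exp_add]

end ExpDecay

theorem integrable_tsum_of_summable_integral_norm {α ι E : Type*} [MeasurableSpace α]
    {μ : Measure α} [Countable ι] [NormedAddCommGroup E] [CompleteSpace E] {F : ι → α → E}
    (hF : ∀ i, Integrable (F i) μ) (hsum : Summable fun i => ∫ a, ‖F i a‖ ∂μ) :
    Integrable (fun a => ∑' i, F i a) μ := by
  refine ⟨AEStronglyMeasurable.tsum fun i => (hF i).1, ?_⟩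
  calc ∫⁻ a, ‖∑' i, F i a‖ₑ ∂μ ≤ ∫⁻ a, ∑' i, ‖F i a‖ₑ ∂μ :=
        lintegral_mono fun a => enorm_tsum_le_tsum_enorm
    _ = ∑' i, ∫⁻ a, ‖F i a‖ₑ ∂μ := lintegral_tsum fun i => (hF i).1.enorm
    _ = ∑' i, ENNReal.ofReal (∫ a, ‖F i a‖ ∂μ) := by
        simp_rw [ofReal_integral_norm_eq_lintegral_enorm (hF _)]
    _ < ⊤ := hsum.tsum_ofReal_lt_top

theorem hasSum_intervalIntegral_sub_intCast {E : Type*} [NormedAddCommGroup E] [NormedSpace ℝ E]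
    {G : ℝ → E} (hG : Integrable G) :
    HasSum (fun k : ℤ => ∫ r in (0 : ℝ)..1, G (r - k)) (∫ s, G s) := by
  simpa [Function.comp_def, sub_eq_add_neg] using
    (Equiv.neg ℤ).hasSum_iff.2 hG.hasSum_intervalIntegral_comp_add_int

theorem summable_integral_norm_sub_intCast {E : Type*} [NormedAddCommGroup E] {G : ℝ → E}
    (hG : Integrable G) : Summable fun k : ℤ => ∫ r in Set.Ioc (0 : ℝ) 1, ‖G (r - k)‖ := by
  simpa only [intervalIntegral.integral_of_le zero_le_one] using
    (hasSum_intervalIntegral_sub_intCast hG.norm).summable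

theorem intervalIntegrable_tsum_sub_intCast {E : Type*} [NormedAddCommGroup E] [CompleteSpace E]
    {G : ℝ → E} (hG : Integrable G) :
    IntervalIntegrable (fun r : ℝ => ∑' k : ℤ, G (r - k)) volume 0 1 := by
  rw [intervalIntegrable_iff_integrableOn_Ioc_of_le zero_le_one]
  exact integrable_tsum_of_summable_integral_norm
    (fun k => (hG.comp_sub_right (k : ℝ)).integrableOn) (summable_integral_norm_sub_intCast hG)

theorem integral_tsum_sub_intCast {E : Type*} [NormedAddCommGroup E] [NormedSpace ℝ E] {G : ℝ → E}
    (hG : Integrable G) : ∫ r in (0 : ℝ)..1, ∑' k : ℤ, G (r - k) = ∫ s, G s := by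
  have hswap := hasSum_integral_of_summable_integral_norm (μ := volume.restrict (Set.Ioc 0 1))
    (fun k : ℤ => (hG.comp_sub_right (k : ℝ)).integrableOn) (summable_integral_norm_sub_intCast hG)
  simp only [← intervalIntegral.integral_of_le zero_le_one] at hswap
  exact hswap.unique (hasSum_intervalIntegral_sub_intCast hG)

theorem integral_pos_of_ae_pos {α : Type*} [MeasurableSpace α] {μ : Measure α} [NeZero μ]
    {f : α → ℝ} (hf : Integrable f μ) (hpos : ∀ᵐ x ∂μ, 0 < f x) : 0 < ∫ x, f x ∂μ := by
  have hnonneg : 0 ≤ᵐ[μ] f := hpos.mono fun _ => le_of_lt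
  refine (integral_nonneg_of_ae hnonneg).lt_of_ne fun hzero => ?_
  obtain ⟨x, hx0, hx⟩ :=
    (((integral_eq_zero_iff_of_nonneg_ae hnonneg hf).1 hzero.symm).and hpos).exists
  exact hx.ne' hx0

theorem ae_prod_fst_ne_snd {α : Type*} [MeasurableSpace α] [MeasurableEq α] {μ ν : Measure α}
    [SFinite ν] [NullSingletonClass ν] : ∀ᵐ z ∂μ.prod ν, z.1 ≠ z.2 := by
  have hsection : ∀ x : α, Prod.mk x ⁻¹' Set.diagonal α = {x} := fun x => by
    ext y
    simp [eq_comm]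
  refine measure_mono_null (t := Set.diagonal α) (fun z hz => not_not.1 hz) ?_
  rw [Measure.measure_prod_null measurableSet_diagonal]
  exact ae_of_all _ fun x => by simp [hsection]

/-- The double integral of `(W x - W y) * (f x * g y - f y * g x)`, which is positive off the
diagonal, is twice the difference of the two sides. -/
theorem integral_mul_integral_lt_of_strictAnti {α : Type*} [LinearOrder α] [MeasurableSpace α]
    [MeasurableEq α] {μ : Measure α} [SFinite μ] [NullSingletonClass μ] [NeZero μ]
    {f g W : α → ℝ} (hf : Integrable f μ) (hg : Integrable g μ)
    (hWf : Integrable (fun x => W x * f x) μ) (hWg : Integrable (fun x => W x * g x) μ)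
    (hpos : ∀ x, 0 < g x) (hfg : StrictAnti fun x => f x / g x) (hW : StrictAnti W) :
    (∫ x, f x ∂μ) * ∫ x, W x * g x ∂μ < (∫ x, W x * f x ∂μ) * ∫ x, g x ∂μ := by
  have hkernel : ∀ x y, x < y → 0 < (W x - W y) * (f x * g y - f y * g x) := fun x y hxy =>
    mul_pos (sub_pos.2 (hW hxy)) (sub_pos.2 ((div_lt_div_iff₀ (hpos y) (hpos x)).1 (hfg hxy)))
  have hkernel_pos : ∀ᵐ z ∂μ.prod μ, 0 < (W z.1 * f z.1 * g z.2 - f z.1 * (W z.2 * g z.2)) +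
      (g z.1 * (W z.2 * f z.2) - W z.1 * g z.1 * f z.2) := by
    filter_upwards [ae_prod_fst_ne_snd] with z hz
    rcases hz.lt_or_gt with hlt | hlt <;> linarith [hkernel _ _ hlt]
  have hWf_g := hWf.mul_prod hg
  have hf_Wg := hf.mul_prod hWg
  have hg_Wf := hg.mul_prod hWf
  have hWg_f := hWg.mul_prod hf
  have : NeZero (μ.prod μ) := ⟨by
    rw [Ne, ← Measure.measure_univ_eq_zero, ← Set.univ_prod_univ, Measure.prod_prod,
      mul_self_eq_zero, Measure.measure_univ_eq_zero]
    exact NeZero.ne μ⟩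
  have hint := integral_pos_of_ae_pos ((hWf_g.sub hf_Wg).add (hg_Wf.sub hWg_f)) hkernel_pos
  rw [integral_add' (hWf_g.sub hf_Wg) (hg_Wf.sub hWg_f), integral_sub' hWf_g hf_Wg,
    integral_sub' hg_Wf hWg_f] at hint
  rw [integral_prod_mul (fun x => W x * f x) g, integral_prod_mul f fun x => W x * g x,
    integral_prod_mul g fun x => W x * f x, integral_prod_mul (fun x => W x * g x) f] at hint
  linarith

theorem negMulLog_le_sqrt_mul_one_sub {u : ℝ} (h0 : 0 ≤ u) (h1 : u ≤ 1) :
    negMulLog u ≤ √u * (1 - u) := by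
  rcases h0.eq_or_lt with rfl | hu
  · simp
  have hroot : 0 < √u := sqrt_pos.2 hu
  have hsinh := self_le_sinh_iff.2 (neg_nonneg.2 (log_nonpos hroot.le (sqrt_le_one.2 h1)))
  rw [sinh_eq, neg_neg, exp_neg, exp_log hroot, log_sqrt h0] at hsinh
  calc negMulLog u = u * -log u := by rw [negMulLog, neg_mul, mul_neg]
    _ ≤ u * ((√u)⁻¹ - √u) := mul_le_mul_of_nonneg_left (by linarith) h0
    _ = √u * (1 - u) := by
      rw [mul_sub, ← div_eq_mul_inv, div_sqrt]
      ring

theorem negMulLog_mul_negMulLog_one_sub_le {y : ℝ} (h0 : 0 ≤ y) (h1 : y ≤ 1) :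
    negMulLog y * negMulLog (1 - y) ≤ y * (1 - y) * binEntropy y := by
  have h0' := sub_nonneg.2 h1
  have h1' := sub_le_self 1 h0
  have hnn := negMulLog_nonneg h0 h1
  have hnn' := negMulLog_nonneg h0' h1'
  have hsqrt : negMulLog y * √y ≤ y * (1 - y) :=
    (mul_le_mul_of_nonneg_right (negMulLog_le_sqrt_mul_one_sub h0 h1) (sqrt_nonneg y)).trans_eq
      (by rw [mul_right_comm, mul_self_sqrt h0])
  have hsqrt' : negMulLog (1 - y) * √(1 - y) ≤ y * (1 - y) :=
    (mul_le_mul_of_nonneg_right (negMulLog_le_sqrt_mul_one_sub h0' h1')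
      (sqrt_nonneg (1 - y))).trans_eq (by rw [mul_right_comm, mul_self_sqrt h0']; ring)
  have hsum : 1 ≤ √y + √(1 - y) := by
    linarith [le_sqrt_self_iff.2 h1, le_sqrt_self_iff.2 h1']
  calc negMulLog y * negMulLog (1 - y)
      ≤ negMulLog y * negMulLog (1 - y) * (√y + √(1 - y)) :=
        le_mul_of_one_le_right (mul_nonneg hnn hnn') hsum
    _ = negMulLog y * √y * negMulLog (1 - y) + negMulLog (1 - y) * √(1 - y) * negMulLog y := by
        ring
    _ ≤ y * (1 - y) * negMulLog (1 - y) + y * (1 - y) * negMulLog y := by gcongr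
    _ = y * (1 - y) * binEntropy y := by
        rw [binEntropy_eq_negMulLog_add_negMulLog_one_sub]
        ring

theorem negMulLog_pos {y : ℝ} (h0 : 0 < y) (h1 : y < 1) : 0 < negMulLog y :=
  mul_pos_of_neg_of_neg (neg_lt_zero.2 h0) (log_neg h0 h1)

theorem hasDerivAt_negMulLog_one_sub_div_negMulLog {y : ℝ} (h0 : 0 < y) (h1 : y < 1) :
    HasDerivAt (fun y => negMulLog (1 - y) / negMulLog y)
      ((y * (1 - y) * binEntropy y - negMulLog y * negMulLog (1 - y)) /
        (y * (1 - y) * negMulLog y ^ 2)) y := by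
  have h1' : 0 < 1 - y := sub_pos.2 h1
  have hnum := (hasDerivAt_negMulLog h1'.ne').comp y ((hasDerivAt_id y).const_sub 1)
  refine (hnum.div (hasDerivAt_negMulLog h0.ne') (negMulLog_pos h0 h1).ne').congr_deriv ?_
  have hne := (log_neg h0 h1).ne
  rw [binEntropy_eq_negMulLog_add_negMulLog_one_sub]
  simp only [negMulLog, Function.comp_apply]
  field_simp
  ring

theorem monotoneOn_negMulLog_one_sub_div_negMulLog :
    MonotoneOn (fun y => negMulLog (1 - y) / negMulLog y) (Set.Ioo 0 1) := by
  have hderiv : ∀ y ∈ Set.Ioo (0 : ℝ) 1, HasDerivAt _ _ y := fun y hy =>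
    hasDerivAt_negMulLog_one_sub_div_negMulLog hy.1 hy.2
  refine monotoneOn_of_hasDerivWithinAt_nonneg (convex_Ioo 0 1)
    (fun y hy => (hderiv y hy).continuousAt.continuousWithinAt)
    (fun y hy => (hderiv y (interior_subset hy)).hasDerivWithinAt) fun y hy => ?_
  rw [interior_Ioo] at hy
  have hy' : 0 < 1 - y := sub_pos.2 hy.2
  exact div_nonneg (sub_nonneg.2 (negMulLog_mul_negMulLog_one_sub_le hy.1.le hy.2.le))
    (mul_nonneg (mul_pos hy.1 hy').le (sq_nonneg _))

theorem strictAntiOn_one_sub_exp_neg_div :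
    StrictAntiOn (fun x : ℝ => (1 - exp (-x)) / x) (Set.Ioi 0) := by
  intro x hx y hy hxy
  have hx0 : (0 : ℝ) < x := hx
  have hy0 : (0 : ℝ) < y := hy
  have hsecant := strictConvexOn_exp.secant_strict_mono (Set.mem_univ 0) (Set.mem_univ (-y))
    (Set.mem_univ (-x)) (neg_ne_zero.2 hy0.ne') (neg_ne_zero.2 hx0.ne') (neg_lt_neg hxy)
  simpa only [exp_zero, sub_zero, ← neg_sub (1 : ℝ), neg_div_neg_eq] using hsecant

theorem exp_neg_mem_Ioo {x : ℝ} (hx : 0 < x) : exp (-x) ∈ Set.Ioo (0 : ℝ) 1 :=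
  ⟨exp_pos _, exp_lt_one_iff.2 (neg_lt_zero.2 hx)⟩

theorem negMulLog_exp_neg (x : ℝ) : negMulLog (exp (-x)) = x * exp (-x) := by
  rw [negMulLog, log_exp]
  ring

theorem h_eq_negMulLog_add (y : ℝ) : h y = negMulLog y + negMulLog (1 - y) := by
  simp only [h, negMulLog]
  ring

theorem g_eq_exp_neg (x : ℝ) : g x = x ^ 2 * exp (-x) / (1 - exp (-x)) := by
  rw [g, ← mul_div_mul_right _ _ (exp_pos (-x)).ne', sub_mul, one_mul, ← exp_add, add_neg_cancel,
    exp_zero]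

theorem g_pos {x : ℝ} (hx : 0 < x) : 0 < g x :=
  div_pos (by positivity) (sub_pos.2 (one_lt_exp_iff.2 hx))

theorem h_exp_neg_div_g {x : ℝ} (hx : 0 < x) :
    h (exp (-x)) / g x =
      (1 - exp (-x)) / x * (1 + negMulLog (1 - exp (-x)) / negMulLog (exp (-x))) := by
  have hy := exp_neg_mem_Ioo hx
  have hy' := (sub_pos.2 hy.2).ne'
  rw [h_eq_negMulLog_add, g_eq_exp_neg, negMulLog_exp_neg]
  generalize negMulLog (1 - exp (-x)) = n
  have := hy.1.ne'
  field_simp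

theorem strictAntiOn_h_exp_neg_div_g :
    StrictAntiOn (fun x : ℝ => h (exp (-x)) / g x) (Set.Ioi 0) := by
  intro a ha b hb hab
  have hya := exp_neg_mem_Ioo ha
  have hyb := exp_neg_mem_Ioo hb
  have hratio := monotoneOn_negMulLog_one_sub_div_negMulLog hyb hya
    (exp_le_exp.2 (neg_le_neg hab.le))
  have hratio_pos : 0 < negMulLog (1 - exp (-b)) / negMulLog (exp (-b)) :=
    div_pos (negMulLog_pos (sub_pos.2 hyb.2) (sub_lt_self 1 hyb.1)) (negMulLog_pos hyb.1 hyb.2)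
  simp only [h_exp_neg_div_g (Set.mem_Ioi.1 ha), h_exp_neg_div_g (Set.mem_Ioi.1 hb)]
  exact mul_lt_mul (strictAntiOn_one_sub_exp_neg_div ha hb hab) (add_le_add le_rfl hratio)
    (add_pos one_pos hratio_pos) (div_nonneg (sub_pos.2 hya.2).le (Set.mem_Ioi.1 ha).le)

/-- The probability that a Poisson variable of rate `exp r` takes the value `n`, up to the
factor `n!`. -/
noncomputable def poissonTerm (n : ℕ) (r : ℝ) : ℝ :=
  exp r ^ n * exp (-exp r)

theorem expDecay_poissonTerm {n : ℕ} (hn : n ≠ 0) : ExpDecay (poissonTerm n) := by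
  refine ExpDecay.of_abs_le_rpow_mul_exp (F := fun x => x ^ n * exp (-x)) (p := n) (by fun_prop)
    (Nat.cast_pos.2 hn.bot_lt) one_pos fun x hx => ?_
  rw [abs_of_pos (by positivity), rpow_natCast, one_mul]

theorem g_le_mul_exp {x : ℝ} (hx : 0 < x) : g x ≤ x * exp (-(1 / 2 * x)) := by
  have hsinh := self_le_sinh_iff.2 (half_pos hx).le
  have hexp : exp (-(1 / 2 * x)) * (exp x - 1) = 2 * sinh (x / 2) := by
    rw [sinh_eq, mul_sub, ← exp_add]
    ring_nf
  rw [g, div_le_iff₀ (sub_pos.2 (one_lt_exp_iff.2 hx)), mul_assoc, hexp, sq]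
  exact mul_le_mul_of_nonneg_left (by linarith) hx.le

theorem expDecay_g : ExpDecay fun w => g (exp w) := by
  refine ExpDecay.of_abs_le_rpow_mul_exp (p := 1) (c := 1 / 2) ?_ one_pos one_half_pos
    fun x hx => ?_
  · exact Continuous.div (by fun_prop) (by fun_prop)
      fun w => (sub_pos.2 (one_lt_exp_iff.2 (exp_pos w))).ne'
  · rw [abs_of_pos (g_pos hx), rpow_one]
    exact g_le_mul_exp hx

theorem expDecay_negMulLog_one_sub_exp_neg :
    ExpDecay fun w => negMulLog (1 - exp (-exp w)) := by
  refine ExpDecay.of_abs_le_rpow_mul_exp (F := fun x => negMulLog (1 - exp (-x))) (p := 1 / 2)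
    (by fun_prop) one_half_pos one_pos fun x hx => ?_
  have h0 := (sub_pos.2 (exp_neg_mem_Ioo hx).2).le
  have h1 := sub_le_self 1 (exp_neg_mem_Ioo hx).1.le
  rw [abs_of_nonneg (negMulLog_nonneg h0 h1), ← sqrt_eq_rpow, one_mul]
  calc negMulLog (1 - exp (-x)) ≤ √(1 - exp (-x)) * (1 - (1 - exp (-x))) :=
        negMulLog_le_sqrt_mul_one_sub h0 h1
    _ ≤ √x * exp (-x) := by
        rw [sub_sub_cancel]
        gcongr
        exact sub_le_comm.1 (one_sub_le_exp_neg x)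

theorem expDecay_h : ExpDecay fun w => h (exp (-exp w)) := by
  simpa only [h_eq_negMulLog_add, negMulLog_exp_neg, poissonTerm, pow_one] using
    (expDecay_poissonTerm one_ne_zero).add expDecay_negMulLog_one_sub_exp_neg

variable {q : ℝ}

/-- The probability that all columns above the current one of a base-`q` sketch are empty, as a
function of the logarithm `w` of the rate of the current column. The rates decrease by a factor `q`
from each column to the next, so those above have total rate `exp w / (q - 1)`. -/
noncomputable def emptyAboveProb (q w : ℝ) : ℝ :=
  exp (-(exp w / (q - 1)))

theorem continuous_emptyAboveProb (q : ℝ) : Continuous (emptyAboveProb q) := by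
  unfold emptyAboveProb
  fun_prop

theorem abs_emptyAboveProb_le_one (hq : 1 < q) (w : ℝ) : |emptyAboveProb q w| ≤ 1 := by
  rw [emptyAboveProb, abs_exp, exp_le_one_iff, neg_nonpos]
  exact div_nonneg (exp_pos w).le (sub_pos.2 hq).le

theorem strictAnti_emptyAboveProb (hq : 1 < q) : StrictAnti (emptyAboveProb q) := fun _ _ hab =>
  exp_lt_exp.2 (neg_lt_neg (div_lt_div_of_pos_right (exp_lt_exp.2 hab) (sub_pos.2 hq)))

theorem tendsto_emptyAboveProb (w : ℝ) : Tendsto (fun q => emptyAboveProb q w) atTop (𝓝 1) := by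
  have hrate : Tendsto (fun q : ℝ => exp w / (q - 1)) atTop (𝓝 0) :=
    tendsto_const_nhds.div_atTop (tendsto_atTop_add_const_right _ _ tendsto_id)
  simpa [emptyAboveProb, Function.comp_def] using (continuous_exp.tendsto _).comp hrate.neg

theorem emptyAboveProb_add_log (hq : 1 < q) (r : ℝ) :
    emptyAboveProb q (r + log (q - 1)) = exp (-exp r) := by
  have hq1 : 0 < q - 1 := sub_pos.2 hq
  rw [emptyAboveProb, exp_add, exp_log hq1, mul_div_cancel_right₀ _ hq1.ne']

theorem expDecay_emptyAboveProb_mul_h (hq : 1 < q) :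
    ExpDecay fun w => emptyAboveProb q w * h (exp (-exp w)) :=
  expDecay_h.bdd_mul (continuous_emptyAboveProb q) (abs_emptyAboveProb_le_one hq)

theorem expDecay_emptyAboveProb_mul_g (hq : 1 < q) :
    ExpDecay fun w => emptyAboveProb q w * g (exp w) :=
  expDecay_g.bdd_mul (continuous_emptyAboveProb q) (abs_emptyAboveProb_le_one hq)

theorem tendsto_integral_emptyAboveProb_mul {G : ℝ → ℝ} (hG : Integrable G) :
    Tendsto (fun q => ∫ w, emptyAboveProb q w * G w) atTop (𝓝 (∫ w, G w)) := by
  refine tendsto_integral_filter_of_dominated_convergence (fun w => ‖G w‖) ?_ ?_ hG.norm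
    (ae_of_all _ fun w => ?_)
  · exact Eventually.of_forall fun q =>
      (continuous_emptyAboveProb q).aestronglyMeasurable.mul hG.1
  · filter_upwards [eventually_gt_atTop 1] with q hq
    refine ae_of_all _ fun w => ?_
    rw [norm_mul]
    exact mul_le_of_le_one_left (norm_nonneg _) (abs_emptyAboveProb_le_one hq w)
  · simpa using (tendsto_emptyAboveProb w).mul_const (G w)

theorem exp_neg_mul_eq_mul_exp (q x : ℝ) :
    exp (-(x * q)) = exp (-x) * exp (-(x * (q - 1))) := by
  rw [← exp_add]
  ring_nf

theorem exp_neg_sub_exp_neg_mul (q x : ℝ) :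
    exp (-x) - exp (-(x * q)) = exp (-x) * (1 - exp (-(x * (q - 1)))) := by
  rw [mul_one_sub, exp_neg_mul_eq_mul_exp]

theorem phiIntegrand_eq_shift_add_sub (hq : 1 < q) (r : ℝ) :
    phiIntegrand q r = (log 2)⁻¹ *
      (emptyAboveProb q (r + log (q - 1)) * h (exp (-exp (r + log (q - 1)))) +
        (poissonTerm 1 r - poissonTerm 1 (r + log q))) := by
  have hnats : phiIntegrand q r =
      (log 2)⁻¹ * negMulLog (exp (-exp r) - exp (-(exp r * q))) := by
    rw [phiIntegrand, logb, negMulLog]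
    ring
  rw [hnats, exp_neg_sub_exp_neg_mul, negMulLog_mul, negMulLog_exp_neg]
  simp only [emptyAboveProb_add_log hq, poissonTerm, exp_add, exp_log (sub_pos.2 hq),
    exp_log (one_pos.trans hq), exp_neg_mul_eq_mul_exp q, h_eq_negMulLog_add, negMulLog_exp_neg]
  ring

theorem rhoIntegrand_eq_shift_add_sub (hq : 1 < q) (r : ℝ) :
    rhoIntegrand q r = emptyAboveProb q (r + log (q - 1)) * g (exp (r + log (q - 1))) +
      (poissonTerm 2 r - poissonTerm 2 (r + log q)) := by
  have hne : 1 - exp (-(exp r * (q - 1))) ≠ 0 :=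
    (sub_pos.2 (exp_neg_mem_Ioo (mul_pos (exp_pos r) (sub_pos.2 hq))).2).ne'
  simp only [rhoIntegrand, emptyAboveProb_add_log hq, poissonTerm, exp_add,
    exp_log (sub_pos.2 hq), exp_log (one_pos.trans hq), exp_neg_mul_eq_mul_exp q, g_eq_exp_neg]
  have := (exp_pos (-exp r)).ne'
  field_simp
  ring

theorem expDecay_phiIntegrand (hq : 1 < q) : ExpDecay (phiIntegrand q) := by
  rw [funext (phiIntegrand_eq_shift_add_sub hq)]
  exact ((expDecay_emptyAboveProb_mul_h hq).shift_add_sub (expDecay_poissonTerm one_ne_zero)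
    _ _).const_mul _

theorem expDecay_rhoIntegrand (hq : 1 < q) : ExpDecay (rhoIntegrand q) := by
  rw [funext (rhoIntegrand_eq_shift_add_sub hq)]
  exact (expDecay_emptyAboveProb_mul_g hq).shift_add_sub (expDecay_poissonTerm two_ne_zero) _ _

theorem phi_eq_integral_emptyAboveProb_mul (hq : 1 < q) :
    phi q = (log 2)⁻¹ * ∫ w, emptyAboveProb q w * h (exp (-exp w)) := by
  simp_rw [phi, phiIntegrand_eq_shift_add_sub hq]
  rw [integral_const_mul, (expDecay_emptyAboveProb_mul_h hq).integral_shift_add_sub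
    (expDecay_poissonTerm one_ne_zero) (log (q - 1)) (log q)]

theorem rho_eq_integral_emptyAboveProb_mul (hq : 1 < q) :
    rho q = ∫ w, emptyAboveProb q w * g (exp w) := by
  simp_rw [rho, rhoIntegrand_eq_shift_add_sub hq]
  exact (expDecay_emptyAboveProb_mul_g hq).integral_shift_add_sub
    (expDecay_poissonTerm two_ne_zero) (log (q - 1)) (log q)

theorem I₀_pos : 0 < I₀ :=
  integral_pos_of_ae_pos expDecay_g.integrable (ae_of_all _ fun w => g_pos (exp_pos w))

theorem rho_pos (hq : 1 < q) : 0 < rho q := by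
  rw [rho_eq_integral_emptyAboveProb_mul hq]
  exact integral_pos_of_ae_pos (expDecay_emptyAboveProb_mul_g hq).integrable
    (ae_of_all _ fun w => mul_pos (exp_pos _) (g_pos (exp_pos w)))

theorem H₀_div_I₀_lt_phi_div_rho (hq : 1 < q) : H₀ / I₀ < phi q / rho q := by
  have hratio : StrictAnti fun w => h (exp (-exp w)) / g (exp w) := fun a b hab =>
    strictAntiOn_h_exp_neg_div_g (exp_pos a) (exp_pos b) (exp_lt_exp.2 hab)
  have hchebyshev := integral_mul_integral_lt_of_strictAnti expDecay_h.integrable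
    expDecay_g.integrable (expDecay_emptyAboveProb_mul_h hq).integrable
    (expDecay_emptyAboveProb_mul_g hq).integrable (fun w => g_pos (exp_pos w)) hratio
    (strictAnti_emptyAboveProb hq)
  rw [div_lt_div_iff₀ I₀_pos (rho_pos hq), phi_eq_integral_emptyAboveProb_mul hq,
    rho_eq_integral_emptyAboveProb_mul hq, H₀, I₀, one_div, mul_assoc, mul_assoc]
  exact mul_lt_mul_of_pos_left hchebyshev (inv_pos.2 (log_pos one_lt_two))

theorem tendsto_phi_div_rho : Tendsto (fun q => phi q / rho q) atTop (𝓝 (H₀ / I₀)) := by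
  have hphi : Tendsto phi atTop (𝓝 H₀) := by
    rw [H₀, one_div]
    refine ((tendsto_integral_emptyAboveProb_mul expDecay_h.integrable).const_mul _).congr' ?_
    filter_upwards [eventually_gt_atTop 1] with q hq
    exact (phi_eq_integral_emptyAboveProb_mul hq).symm
  have hrho : Tendsto rho atTop (𝓝 I₀) := by
    refine (tendsto_integral_emptyAboveProb_mul expDecay_g.integrable).congr' ?_
    filter_upwards [eventually_gt_atTop 1] with q hq
    exact (rho_eq_integral_emptyAboveProb_mul hq).symm
  exact hphi.div hrho I₀_pos.ne'

theorem hasSum_sub_of_monotone_nat {f : ℕ → ℝ} {b : ℝ} (hf : Monotone f)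
    (hb : Tendsto f atTop (𝓝 b)) : HasSum (fun n => f (n + 1) - f n) (b - f 0) := by
  rw [hasSum_iff_tendsto_nat_of_nonneg fun n => sub_nonneg.2 (hf n.le_succ)]
  simpa only [Finset.sum_range_sub] using hb.sub_const (f 0)

theorem hasSum_sub_of_monotone_int {F : ℤ → ℝ} {a b : ℝ} (hF : Monotone F)
    (ha : Tendsto F atBot (𝓝 a)) (hb : Tendsto F atTop (𝓝 b)) :
    HasSum (fun k => F k - F (k - 1)) (b - a) := by
  have hup : HasSum (fun n : ℕ => F ((n : ℤ) + 1) - F n) (b - F 0) :=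
    hasSum_sub_of_monotone_nat (f := fun n => F n) (fun m n hmn => hF (Int.ofNat_le.2 hmn))
      (hb.comp tendsto_natCast_atTop_atTop)
  have hdown : HasSum (fun n : ℕ => F (-n) - F (-(n + 1))) (F 0 - a) := by
    have hreflect := hasSum_sub_of_monotone_nat (f := fun n => -F (-n))
      (fun m n hmn => neg_le_neg (hF (neg_le_neg (Int.ofNat_le.2 hmn))))
      (ha.comp (tendsto_neg_atTop_atBot.comp tendsto_natCast_atTop_atTop)).neg
    simpa only [Nat.cast_add, Nat.cast_one, Nat.cast_zero, neg_zero, neg_sub_neg] using hreflect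
  have hall := hup.of_nat_of_neg_add_one (f := fun k => F (k + 1) - F k)
    (by simpa only [neg_add, neg_add_cancel_right] using hdown)
  rw [sub_add_sub_cancel] at hall
  rw [← (Equiv.addRight (1 : ℤ)).hasSum_iff]
  simpa [Function.comp_def] using hall

variable {t : ℝ}

theorem qLL_pos (hq : 1 < q) (ht : 0 < t) (k : ℤ) : 0 < qLL q t k :=
  sub_pos.2 <| exp_lt_exp.2 <| neg_lt_neg <| div_lt_div_of_pos_left ht
    (zpow_pos (one_pos.trans hq) _) (zpow_lt_zpow_right₀ hq (sub_one_lt k))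

theorem hasSum_qLL (hq : 1 < q) (ht : 0 < t) : HasSum (qLL q t) 1 := by
  have hmono : Monotone fun k : ℤ => exp (-(t / q ^ k)) := monotone_int_of_le_succ fun k => by
    simpa only [qLL, add_sub_cancel_right, sub_nonneg] using (qLL_pos hq ht (k + 1)).le
  have hpow : Tendsto (fun k : ℤ => q ^ k) atTop atTop := by
    simpa [Function.comp_def] using
      (tendsto_rpow_atTop_of_base_gt_one q hq).comp tendsto_intCast_atTop_atTop
  have htop : Tendsto (fun k : ℤ => exp (-(t / q ^ k))) atTop (𝓝 1) := by
    simpa using ((tendsto_const_nhds (x := t)).div_atTop hpow).neg.rexp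
  have hbot : Tendsto (fun k : ℤ => exp (-(t / q ^ k))) atBot (𝓝 0) := by
    refine tendsto_exp_neg_atTop_nhds_zero.comp ?_
    simpa [Function.comp_def, div_eq_mul_inv] using
      (hpow.comp tendsto_neg_atBot_atTop).const_mul_atTop ht
  have htelescope := hasSum_sub_of_monotone_int hmono hbot htop
  rwa [sub_zero] at htelescope

theorem isInducedFamily_qLL (hq : 1 < q) : IsInducedFamily (qLL q) :=
  ⟨fun _ ht k => (qLL_pos hq ht k).le, fun _ ht => hasSum_qLL hq ht⟩

theorem weaklyScaleInvariant_of_equiv {M : Type*} {ψ : ℝ → M → ℝ} (e : M ≃ M)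
    (hψ : ∀ t x, ψ (q * t) (e x) = ψ t x) : WeaklyScaleInvariant ψ q := by
  refine fun t _ => ⟨?_, ?_⟩
  · rw [entropy, entropy, ← e.tsum_eq (entropyTerm (ψ (q * t)))]
    simp only [entropyTerm, hψ]
  · have hderiv : ∀ x, deriv (fun s => ψ s x) t = q * deriv (fun s => ψ s (e x)) (q * t) :=
      fun x => by simpa only [hψ, smul_eq_mul] using deriv_comp_mul_left q (fun s => ψ s (e x)) t
    rw [fisherInfo, fisherInfo, ← tsum_mul_left,
      ← e.tsum_eq fun x => q ^ 2 * fisherTerm ψ (q * t) x]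
    refine tsum_congr fun x => ?_
    rw [fisherTerm, fisherTerm, hderiv, hψ]
    ring

theorem weaklyScaleInvariant_qLL (hq : 1 < q) : WeaklyScaleInvariant (qLL q) q := by
  have hq0 : q ≠ 0 := (one_pos.trans hq).ne'
  refine weaklyScaleInvariant_of_equiv (Equiv.addRight (1 : ℤ)) fun t k => ?_
  simp only [qLL, Equiv.coe_addRight, add_sub_right_comm k 1 1, zpow_add_one₀ hq0]
  simp only [mul_comm q t, mul_div_mul_right _ _ hq0]

theorem exp_logb_sub_mul_log (hq : 1 < q) (ht : 0 < t) (k : ℤ) :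
    exp ((logb q t - k) * log q) = t / q ^ k := by
  have hq0 : 0 < q := one_pos.trans hq
  rw [mul_comm, exp_mul, exp_log hq0, rpow_sub hq0, rpow_logb hq0 hq.ne' ht, rpow_intCast]

theorem qLL_eq_exp_sub_exp_mul (hq : 1 < q) (t : ℝ) (k : ℤ) :
    qLL q t k = exp (-(t / q ^ k)) - exp (-(t / q ^ k * q)) := by
  rw [qLL, zpow_sub_one₀ (one_pos.trans hq).ne', div_mul_eq_div_div, div_inv_eq_mul]

theorem entropyTerm_qLL (hq : 1 < q) (ht : 0 < t) (k : ℤ) :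
    entropyTerm (qLL q t) k = phiIntegrand q ((logb q t - k) * log q) := by
  rw [entropyTerm, phiIntegrand, exp_logb_sub_mul_log hq ht, qLL_eq_exp_sub_exp_mul hq,
    mul_neg, neg_mul]

theorem hasDerivAt_qLL (hq : 1 < q) (t : ℝ) (k : ℤ) :
    HasDerivAt (fun s => qLL q s k)
      (-(1 / q ^ k * exp (-(t / q ^ k))) + 1 / q ^ k * q * exp (-(t / q ^ k * q))) t := by
  simp_rw [qLL_eq_exp_sub_exp_mul hq]
  have hrate : HasDerivAt (fun s : ℝ => s / q ^ k) (1 / q ^ k) t := (hasDerivAt_id t).div_const _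
  exact (hrate.neg.exp.sub (hrate.mul_const q).neg.exp).congr_deriv
    (by simp only [Pi.neg_apply]; ring)

theorem sq_mul_fisherTerm_qLL (hq : 1 < q) (ht : 0 < t) (k : ℤ) :
    t ^ 2 * fisherTerm (qLL q) t k = rhoIntegrand q ((logb q t - k) * log q) := by
  have hne := (qLL_pos hq ht k).ne'
  rw [fisherTerm, (hasDerivAt_qLL hq t k).deriv, rhoIntegrand, exp_logb_sub_mul_log hq ht,
    ← qLL_eq_exp_sub_exp_mul hq]
  field_simp

theorem summable_entropyTerm_qLL (hq : 1 < q) (ht : 0 < t) :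
    Summable (entropyTerm (qLL q t)) := by
  rw [funext (entropyTerm_qLL hq ht)]
  exact ((expDecay_phiIntegrand hq).comp_mul_right (log_pos hq)).summable_sub_intCast _

theorem summable_fisherTerm_qLL (hq : 1 < q) (ht : 0 < t) : Summable (fisherTerm (qLL q) t) := by
  rw [← summable_mul_left_iff (pow_pos ht 2).ne', funext (sq_mul_fisherTerm_qLL hq ht)]
  exact ((expDecay_rhoIntegrand hq).comp_mul_right (log_pos hq)).summable_sub_intCast _

theorem entropy_qLL_rpow (hq : 1 < q) (r : ℝ) :
    entropy (qLL q (q ^ r)) = ∑' k : ℤ, phiIntegrand q ((r - k) * log q) := by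
  have hq0 : 0 < q := one_pos.trans hq
  simp_rw [entropy, entropyTerm_qLL hq (rpow_pos_of_pos hq0 r), logb_rpow hq0 hq.ne']

theorem rpow_mul_fisherInfo_qLL_rpow (hq : 1 < q) (r : ℝ) :
    q ^ (2 * r) * fisherInfo (qLL q) (q ^ r) = ∑' k : ℤ, rhoIntegrand q ((r - k) * log q) := by
  have hq0 : 0 < q := one_pos.trans hq
  rw [mul_comm 2 r, rpow_mul hq0.le, rpow_two, fisherInfo, ← tsum_mul_left]
  simp_rw [sq_mul_fisherTerm_qLL hq (rpow_pos_of_pos hq0 r), logb_rpow hq0 hq.ne']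

theorem intervalIntegrable_entropy_qLL (hq : 1 < q) :
    IntervalIntegrable (fun r : ℝ => entropy (qLL q (q ^ r))) volume 0 1 := by
  simp_rw [entropy_qLL_rpow hq]
  exact intervalIntegrable_tsum_sub_intCast
    ((expDecay_phiIntegrand hq).comp_mul_right (log_pos hq)).integrable

theorem intervalIntegrable_rpow_mul_fisherInfo_qLL (hq : 1 < q) :
    IntervalIntegrable (fun r : ℝ => q ^ (2 * r) * fisherInfo (qLL q) (q ^ r)) volume 0 1 := by
  simp_rw [rpow_mul_fisherInfo_qLL_rpow hq]
  exact intervalIntegrable_tsum_sub_intCast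
    ((expDecay_rhoIntegrand hq).comp_mul_right (log_pos hq)).integrable

theorem ExpDecay.integral_tsum_sub_intCast_mul {G : ℝ → ℝ} (hG : ExpDecay G) {b : ℝ}
    (hb : 0 < b) : ∫ r in (0 : ℝ)..1, ∑' k : ℤ, G ((r - k) * b) = (∫ s, G s) / b := by
  rw [integral_tsum_sub_intCast (G := fun s => G (s * b)) (hG.comp_mul_right hb).integrable,
    Measure.integral_comp_mul_right G, abs_of_pos (inv_pos.2 hb), smul_eq_mul, div_eq_inv_mul]

theorem avgEntropy_qLL (hq : 1 < q) : avgEntropy (qLL q) q = phi q / log q := by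
  simp_rw [avgEntropy, entropy_qLL_rpow hq]
  exact (expDecay_phiIntegrand hq).integral_tsum_sub_intCast_mul (log_pos hq)

theorem avgInfo_qLL (hq : 1 < q) : avgInfo (qLL q) q = rho q / log q := by
  simp_rw [avgInfo, rpow_mul_fisherInfo_qLL_rpow hq]
  exact (expDecay_rhoIntegrand hq).integral_tsum_sub_intCast_mul (log_pos hq)

theorem avgInfo_qLL_pos (hq : 1 < q) : 0 < avgInfo (qLL q) q := by
  rw [avgInfo_qLL hq]
  exact div_pos (rho_pos hq) (log_pos hq)

theorem fish_qLL (hq : 1 < q) : fish (qLL q) q = phi q / rho q := by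
  rw [fish, avgEntropy_qLL hq, avgInfo_qLL hq, div_div_div_cancel_right₀ (log_pos hq).ne']

theorem tendsto_fish_qLL : Tendsto (fun q => fish (qLL q) q) atTop (𝓝 (H₀ / I₀)) := by
  refine tendsto_phi_div_rho.congr' ?_
  filter_upwards [eventually_gt_atTop 1] with q hq using (fish_qLL hq).symm

end Sketch

theorem theorem4p6 :
    -- the integrals that define `H₀` and `I₀` converge, and `H₀ / I₀` is a genuine quotient
    (Integrable (fun w : ℝ => Sketch.h (Real.exp (-Real.exp w))) ∧
      Integrable (fun w : ℝ => Sketch.g (Real.exp w)) ∧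
      0 < Sketch.I₀) ∧
    (∀ q : ℝ, 1 < q →
      -- the Fish number of `q`-LL is well defined
      Sketch.IsInducedFamily (Sketch.qLL q) ∧
      (∀ t : ℝ, 0 < t → Summable (Sketch.entropyTerm (Sketch.qLL q t))) ∧
      (∀ t : ℝ, 0 < t → Summable (Sketch.fisherTerm (Sketch.qLL q) t)) ∧
      Sketch.WeaklyScaleInvariant (Sketch.qLL q) q ∧
      IntervalIntegrable (fun r : ℝ => Sketch.entropy (Sketch.qLL q (q ^ r))) volume 0 1 ∧
      IntervalIntegrable
        (fun r : ℝ => q ^ (2 * r) * Sketch.fisherInfo (Sketch.qLL q) (q ^ r)) volume 0 1 ∧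
      0 < Sketch.avgInfo (Sketch.qLL q) q ∧
      -- it equals `φ(q) / ρ(q)`
      Integrable (Sketch.phiIntegrand q) ∧
      Integrable (Sketch.rhoIntegrand q) ∧
      0 < Sketch.rho q ∧
      Sketch.fish (Sketch.qLL q) q = Sketch.phi q / Sketch.rho q ∧
      -- and it is strictly larger than `H₀ / I₀`
      Sketch.fish (Sketch.qLL q) q > Sketch.H₀ / Sketch.I₀) ∧
    Tendsto (fun q : ℝ => Sketch.fish (Sketch.qLL q) q) atTop
      (𝓝 (Sketch.H₀ / Sketch.I₀)) := by
  refine ⟨⟨Sketch.expDecay_h.integrable, Sketch.expDecay_g.integrable, Sketch.I₀_pos⟩,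
    fun q hq => ?_, Sketch.tendsto_fish_qLL⟩
  have hfish := Sketch.fish_qLL hq
  exact ⟨Sketch.isInducedFamily_qLL hq,
    fun _ ht => Sketch.summable_entropyTerm_qLL hq ht,
    fun _ ht => Sketch.summable_fisherTerm_qLL hq ht,
    Sketch.weaklyScaleInvariant_qLL hq,
    Sketch.intervalIntegrable_entropy_qLL hq,
    Sketch.intervalIntegrable_rpow_mul_fisherInfo_qLL hq,
    Sketch.avgInfo_qLL_pos hq,
    (Sketch.expDecay_phiIntegrand hq).integrable,
    (Sketch.expDecay_rhoIntegrand hq).integrable,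
    Sketch.rho_pos hq,
    hfish,
    hfish ▸ Sketch.H₀_div_I₀_lt_phi_div_rho hq⟩
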